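/- Let $q$ be a prime power, let $r\ge 3$ be a prime with $r\mid q-1$, and let $0\le \ell\le q-1$ be an integer. Let $$S=\{0\le i<\ell: i\not\equiv r-1 \!\!\pmod r\}\ \cup\ \{0\le i<q-1: i\equiv 1\!\!\pmod r\},$$ and let $C=\{(f(x))_{x\in\mathbb F_q^*}: f=\sum_{i\in S}a_iX^i,\ a_i\in\mathbb F_q\}\subseteq\mathbb F_q^{\mathbb F_q^*}$. Write $C^\perp$ for the dual of $C$ with respect to the standard dot product. The (unfolded) quantum Tamo–Barg code with parameters $q,r,\ell$ is the CSS code $$\mathcal C=\mathrm{CSS}(C,C)=\mathrm{span}_{\mathbb C}\Big\{\sum_{y\in C^\perp}|x+y\rangle : x\in C\Big\}\subseteq(\mathbb C^{\mathbb F_q})^{\otimes \mathbb F_q^*},$$ which is well defined when $C^\perp\subseteq C$. The distance of $\mathcal C$ is the largest $d\in\mathbb N$ such that for every set $E$ of fewer than $d$ qudits there is a quantum channel which, for every pure state $\psi$ of $\mathcal C$, recovers $\psi$ from its reduced density matrix on the qudits outside $E$. Its rate is $R=\log_q(\dim_{\mathbb C}\mathcal C)/(q-1)$, and its relative distance is $\delta=d/(q-1)$.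 If $\ell\ge q/2$, then $C^\perp\subseteq C$. Whenever $C^\perp\subseteq C$, the code $\mathcal C$ has a (finite) distance $d$, and $$d\ \ge\ (q-1)\left(1-\frac1{2r}-\sqrt{\frac1{4r^2}+\frac{r-1}{r}\cdot\frac{\ell-1}{q-1}}\right).$$ Moreover, there is an absolute constant $c$, independent of $q,r,\ell$, such that in all these cases $$\delta\ \ge\ 1-\sqrt{\frac{1+R}{2}}-\frac{c}{r}.$$ -/

import Mathlib

open scoped Matrix

noncomputable section

namespace QTB

/-! ### Quantum channels and erasures

The Hilbert space `(ℂ^A)^{⊗ ι}` of a register `ι` of qudits over the alphabet `A` is the space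
`(ι → A) → ℂ` of amplitude functions in the computational basis `A^ι`; operators are matrices
indexed by the computational basis. -/

/-- A quantum channel, i.e. a completely positive trace preserving map, given by finitely many
Kraus operators. -/
def IsQuantumChannel {α β : Type*} [Fintype α] [DecidableEq α] [Fintype β]
    (Φ : Matrix α α ℂ → Matrix β β ℂ) : Prop :=
  ∃ (m : ℕ) (K : Fin m → Matrix β α ℂ),
    ∑ ν, (K ν)ᴴ * K ν = 1 ∧ ∀ ρ, Φ ρ = ∑ ν, K ν * ρ * (K ν)ᴴ

section Register

variable {ι A : Type*} [Fintype ι] [DecidableEq ι] [Fintype A] [DecidableEq A]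

/-- Glue a string on the complement of `S` and a string on `S` to a string on all of `ι`. -/
def glue (S : Finset ι) (u : {i // i ∉ S} → A) (s : {i // i ∈ S} → A) : ι → A :=
  fun i => if h : i ∈ S then s ⟨i, h⟩ else u ⟨i, h⟩

/-- The reduced density matrix on the complement of `S`: the partial trace over the qudits
in `S`. -/
def traceOut (S : Finset ι) (ρ : Matrix (ι → A) (ι → A) ℂ) :
    Matrix ({i // i ∉ S} → A) ({i // i ∉ S} → A) ℂ :=
  Matrix.of fun u v => ∑ s : {i // i ∈ S} → A, ρ (glue S u s) (glue S v s)

/-- The operator `|ψ⟩⟨ψ|`. -/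
def pureState {α : Type*} (ψ : α → ℂ) : Matrix α α ℂ :=
  Matrix.vecMulVec ψ (star ψ)

/-- The quantum code `𝒞` can decode from erasures in `S`: a single channel recovers every
(normalized) code state from its reduced density matrix on the complement of `S`. -/
def DecodesErasures (𝒞 : Submodule ℂ ((ι → A) → ℂ)) (S : Finset ι) : Prop :=
  ∃ Dec : Matrix ({i // i ∉ S} → A) ({i // i ∉ S} → A) ℂ → Matrix (ι → A) (ι → A) ℂ,
    IsQuantumChannel Dec ∧
      ∀ ψ ∈ 𝒞, star ψ ⬝ᵥ ψ = 1 → Dec (traceOut S (pureState ψ)) = pureState ψ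

/-- `d` is the distance of the quantum code `𝒞`: the maximum natural number such that `𝒞` can
decode from erasures in every set of fewer than `d` qudits. -/
def HasDistance (𝒞 : Submodule ℂ ((ι → A) → ℂ)) (d : ℕ) : Prop :=
  IsGreatest {e : ℕ | ∀ S : Finset ι, S.card < e → DecodesErasures 𝒞 S} d

/-- The rate `k / n` of a quantum code of block length `n = |ι|` over an alphabet of size
`a = |A|`, where the dimension `k` is defined by `dim_ℂ 𝒞 = a ^ k`. -/
def rate (𝒞 : Submodule ℂ ((ι → A) → ℂ)) : ℝ :=
  Real.logb (Fintype.card A) (Module.finrank ℂ 𝒞) / Fintype.card ι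

end Register

/-! ### Linear codes, CSS codes and polynomial evaluation codes -/

section Codes

variable {F : Type*} [Field F]

/-- The dual of a linear code, with respect to the standard dot product. -/
def dualCode {ι : Type*} [Fintype ι] (C : Submodule F (ι → F)) : Submodule F (ι → F) where
  carrier := {c' | ∀ c ∈ C, c' ⬝ᵥ c = 0}
  zero_mem' := fun c _ => zero_dotProduct c
  add_mem' := fun {a b} ha hb c hc => by rw [add_dotProduct, ha c hc, hb c hc, add_zero]
  smul_mem' := fun t a ha c hc => by rw [smul_dotProduct, ha c hc, smul_zero]

open Classical in
/-- The CSS code `CSS(CX, CZ)`, spanned by the vectors `∑_{y ∈ CX^⊥} |x + y⟩` for `x ∈ CZ`. It is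
a well-defined CSS code when `CX^⊥ ⊆ CZ`. -/
def cssCode {ι : Type*} [Fintype ι] [Fintype F] (CX CZ : Submodule F (ι → F)) :
    Submodule ℂ ((ι → F) → ℂ) :=
  Submodule.span ℂ
    {v | ∃ x ∈ CZ, v = ∑ y : ι → F with y ∈ dualCode CX, Pi.single (x + y) (1 : ℂ)}

/-- The polynomials over `F` that involve only monomials `X ^ i` with `i ∈ S`. -/
def polysOn (F : Type*) [Field F] (S : Set ℕ) : Submodule F (Polynomial F) where
  carrier := {f | ∀ i, i ∉ S → f.coeff i = 0}
  zero_mem' := fun i _ => Polynomial.coeff_zero i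
  add_mem' := fun {f g} hf hg i hi => by rw [Polynomial.coeff_add, hf i hi, hg i hi, add_zero]
  smul_mem' := fun t f hf i hi => by rw [Polynomial.coeff_smul, hf i hi, smul_zero]

/-- The evaluation map `f ↦ (f(x))_x`, where `x` ranges over the nonzero elements of `F`. -/
def ev (F : Type*) [Field F] : Polynomial F →ₗ[F] (Fˣ → F) :=
  LinearMap.pi fun x => Polynomial.leval (x : F)

/-- The polynomial evaluation code with monomial support `S`. -/
def evCode (F : Type*) [Field F] (S : Set ℕ) : Submodule F (Fˣ → F) :=
  (polysOn F S).map (ev F)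

/-- The support set
`{0 ≤ i < ℓ : i ≢ r - 1 mod r} ∪ {0 ≤ i < q - 1 : i ≡ 1 mod r}`. -/
def qTBSupport (q r ℓ : ℕ) : Set ℕ :=
  {i | i < ℓ ∧ ¬ i ≡ r - 1 [MOD r]} ∪ {i | i < q - 1 ∧ i ≡ 1 [MOD r]}

/-- The classical code `C` from which the quantum Tamo-Barg code `CSS(C, C)` is built. -/
def qTBClassical (F : Type*) [Field F] [Fintype F] (r ℓ : ℕ) : Submodule F (Fˣ → F) :=
  evCode F (qTBSupport (Fintype.card F) r ℓ)

/-- The (unfolded) quantum Tamo-Barg code `CSS(C, C)` of block length `q - 1` over the alphabet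
`F` with `q` elements. -/
def qTBCode (F : Type*) [Field F] [Fintype F] [DecidableEq F] (r ℓ : ℕ) :
    Submodule ℂ ((Fˣ → F) → ℂ) :=
  cssCode (qTBClassical F r ℓ) (qTBClassical F r ℓ)

end Codes

end QTB

end

/-! CSS(C, C) corrects the erasure of E as soon as every word of C supported in E lies in C^⊥
(`decodesErasures_cssCode`): by duality each coset of C^⊥ in C then has a representative vanishing
on E, and a linear projection reads the coset off the surviving qudits. Hence the distance is at
least the least weight of a word of C \ C^⊥.

Let f be the polynomial of such a word, Z its set of zeros in the unit group, and η a unit of order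
r. Passing to f(ηX) - η f(X) kills exactly the monomials with exponent ≡ 1 mod r. The result is
nonzero, because those monomials alone give words of C^⊥, and its degree is below ℓ. So at most ℓ -
1 points x have both x and ηx in Z (`card_zeros_inter_le`). Cauchy–Schwarz over translates by the
subgroup of order r (`card_mul_sq_le_card_mul_sum_card`) gives r|Z|² ≤ (q-1)(|Z| + (r-1)(ℓ-1)), and
solving this quadratic inequality bounds the weight.

For the bound in terms of R, counting monomials bounds dim C from below, while R ≥ 2 dim C/(q-1) -
1; trading ℓ for R costs O(1/r). -/

namespace QTB

/-! ### Linear algebra: the projection behind the decoder -/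

section Projection

variable {K V : Type*} [Field K] [AddCommGroup V] [Module K V]

/-- If `C ⊓ B ≤ N ≤ C ≤ N ⊔ A`, then there is an idempotent with values in `A` which kills `N` and
`B` and is the identity on `C` modulo `N`. -/
theorem exists_idempotent_of_le_sup {N C A B : Submodule K V} (hNC : N ≤ C) (hB : C ⊓ B ≤ N)
    (hA : C ≤ N ⊔ A) :
    ∃ p : V →ₗ[K] V, (∀ v, p v ∈ A) ∧ (∀ v, p (p v) = p v) ∧ (∀ v ∈ N, p v = 0) ∧
      (∀ v ∈ B, p v = 0) ∧ ∀ v ∈ C, v - p v ∈ N := by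
  obtain ⟨L, hdisj, hsup⟩ := (N ⊓ A).exists_isCompl
  -- `L'` complements `N ⊓ A` inside `C ⊓ A`, so it represents `C / N` by vectors of `A`. The
  -- projection onto it exists because it meets `N ⊔ B` trivially.
  set L' := L ⊓ (C ⊓ A) with hL'
  have hd : Disjoint (N ⊔ B) L' := by
    rw [Submodule.disjoint_def]
    intro x hx hxL
    obtain ⟨hx1, hxC, hxA⟩ := hxL
    obtain ⟨y, hy, s, hs, rfl⟩ := Submodule.mem_sup.1 hx
    have hsC : s ∈ C := by simpa using C.sub_mem hxC (hNC hy)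
    have hsN : s ∈ N := hB ⟨hsC, hs⟩
    exact (Submodule.disjoint_def.1 hdisj) _ ⟨N.add_mem hy hsN, hxA⟩ hx1
  obtain ⟨M, hM, hcompl⟩ := hd.exists_isCompl
  have hker : ∀ v ∈ M, L'.projection M hcompl.symm v = 0 := fun v hv =>
    (Submodule.projection_apply_eq_zero_iff _).2 hv
  refine ⟨L'.projection M hcompl.symm, fun v => ?_, fun v => ?_, fun v hv => ?_, fun v hv => ?_,
    fun v hv => ?_⟩
  · exact (Submodule.projection_apply_mem hcompl.symm v).2.2
  · exact Submodule.projection_apply_left hcompl.symm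
      ⟨_, Submodule.projection_apply_mem hcompl.symm v⟩
  · exact hker v (hM (Submodule.mem_sup_left hv))
  · exact hker v (hM (Submodule.mem_sup_right hv))
  · obtain ⟨y, hy, t, ht, rfl⟩ := Submodule.mem_sup.1 (hA hv)
    have htC : t ∈ C := by simpa using C.sub_mem hv (hNC hy)
    obtain ⟨d, hd, l, hl, rfl⟩ : ∃ d ∈ N ⊓ A, ∃ l ∈ L, d + l = t :=
      Submodule.mem_sup.1 ((codisjoint_iff.1 hsup).ge Submodule.mem_top)
    have hlL : l ∈ L' := ⟨hl, by simpa using C.sub_mem htC (hNC hd.1),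
      by simpa using A.sub_mem ht hd.2⟩
    have h1 : L'.projection M hcompl.symm l = l :=
      Submodule.projection_apply_left hcompl.symm ⟨l, hlL⟩
    rw [map_add, map_add, hker y (hM (Submodule.mem_sup_left hy)),
      hker d (hM (Submodule.mem_sup_left hd.1)), h1]
    have : y + (d + l) - (0 + (0 + l)) = y + d := by abel
    rw [this]
    exact N.add_mem hy hd.1

end Projection

/-! ### Duality of linear codes -/

section Duality

variable {ι F : Type*} [Fintype ι] [DecidableEq ι] [Field F]

theorem exists_dotProduct_ne_zero_of_notMem {W : Submodule F (ι → F)} {c : ι → F} (hc : c ∉ W) :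
    ∃ a ∈ dualCode W, a ⬝ᵥ c ≠ 0 := by
  obtain ⟨f, hf, hW⟩ := Submodule.exists_dual_map_eq_bot_of_notMem hc inferInstance
  have hdot : ∀ v, (dotProductEquiv F ι).symm f ⬝ᵥ v = f v := fun v => by
    rw [← dotProductEquiv_apply_apply, LinearEquiv.apply_symm_apply]
  refine ⟨(dotProductEquiv F ι).symm f, fun w hw => ?_, by rwa [hdot]⟩
  rw [hdot]
  have : f w ∈ W.map f := Submodule.mem_map_of_mem hw
  rwa [hW, Submodule.mem_bot] at this

theorem dualCode_dualCode_le (C : Submodule F (ι → F)) : dualCode (dualCode C) ≤ C := by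
  intro a ha
  by_contra hc
  obtain ⟨b, hb, hne⟩ := exists_dotProduct_ne_zero_of_notMem hc
  exact hne (by rw [dotProduct_comm]; exact ha b hb)

theorem finrank_add_finrank_dualCode (C : Submodule F (ι → F)) :
    Module.finrank F C + Module.finrank F (dualCode C) = Fintype.card ι := by
  have h : (dualCode C).map (dotProductEquiv F ι : (ι → F) →ₗ[F] _) = C.dualAnnihilator := by
    ext f
    constructor
    · rintro ⟨v, hv, rfl⟩
      exact (Submodule.mem_dualAnnihilator _).2 fun w hw => hv w hw
    · intro hf
      refine ⟨(dotProductEquiv F ι).symm f, fun w hw => ?_, by simp⟩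
      rw [← dotProductEquiv_apply_apply, LinearEquiv.apply_symm_apply]
      exact (Submodule.mem_dualAnnihilator _).1 hf w hw
  have h2 := Subspace.finrank_add_finrank_dualAnnihilator_eq C
  rw [Module.finrank_fintype_fun_eq_card] at h2
  rw [← h2, ← h, ← LinearEquiv.finrank_map_eq (dotProductEquiv F ι) (dualCode C)]

/-- The words that vanish at every position in `S`. -/
def vanishingOn {ι : Type*} (F : Type*) [Field F] (S : Finset ι) : Submodule F (ι → F) where
  carrier := {v | ∀ i ∈ S, v i = 0}
  zero_mem' := fun _ _ => rfl
  add_mem' := fun {a b} ha hb i hi => by rw [Pi.add_apply, ha i hi, hb i hi, add_zero]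
  smul_mem' := fun t a ha i hi => by rw [Pi.smul_apply, ha i hi, smul_zero]

/-- If the words of `C` supported in `S` belong to the dual code, then every word of `C` agrees on
`S` with a word of the dual code. -/
theorem le_dualCode_sup_vanishingOn {C : Submodule F (ι → F)} {S : Finset ι}
    (h : C ⊓ vanishingOn F Sᶜ ≤ dualCode C) : C ≤ dualCode C ⊔ vanishingOn F S := by
  intro c hc
  by_contra hcn
  -- The separating word `a` is orthogonal to both summands, so it lies in the double dual, hence in
  -- `C`, and is supported in `S`. By hypothesis it is then in the dual code, which contradicts `a
  -- ⬝ᵥ c ≠ 0`.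
  obtain ⟨a, ha, hne⟩ := exists_dotProduct_ne_zero_of_notMem hcn
  have haC : a ∈ C := dualCode_dualCode_le C fun w hw => ha w (Submodule.mem_sup_left hw)
  have haS : a ∈ vanishingOn F Sᶜ := fun i hi => by
    have := ha (Pi.single i 1) (Submodule.mem_sup_right fun j hj => by
      refine Pi.single_eq_of_ne ?_ _
      rintro rfl
      exact (Finset.mem_compl.1 hi) hj)
    simpa using this
  exact hne (h ⟨haC, haS⟩ c hc)

end Duality

/-! ### Kraus operators and erasure decoding -/

section Channel

theorem isQuantumChannel_of_kraus {α β κ : Type*} [Fintype α] [DecidableEq α] [Fintype β]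
    [Fintype κ] (K : κ → Matrix β α ℂ) (hK : ∑ k, (K k)ᴴ * K k = 1) :
    IsQuantumChannel fun ρ : Matrix α α ℂ => ∑ k, K k * ρ * (K k)ᴴ := by
  refine ⟨Fintype.card κ, fun ν => K ((Fintype.equivFin κ).symm ν), ?_, fun ρ => ?_⟩
  · rw [← hK]
    exact Equiv.sum_comp (Fintype.equivFin κ).symm fun k => (K k)ᴴ * K k
  · exact (Equiv.sum_comp (Fintype.equivFin κ).symm fun k => K k * ρ * (K k)ᴴ).symm

theorem mul_pureState_mul_conjTranspose {α β : Type*} [Fintype α] (K : Matrix β α ℂ) (φ : α → ℂ) :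
    K * pureState φ * Kᴴ = pureState (K *ᵥ φ) := by
  rw [pureState, Matrix.mul_vecMulVec, Matrix.vecMulVec_mul, pureState, Matrix.star_mulVec]

theorem pureState_smul {α : Type*} (c : ℂ) (φ : α → ℂ) :
    pureState (c • φ) = (c * star c) • pureState φ := by
  ext i j
  simp [pureState, Matrix.vecMulVec_apply]
  ring

variable {ι A : Type*} [DecidableEq ι] [Fintype A]

theorem traceOut_pureState (S : Finset ι) (ψ : (ι → A) → ℂ) :
    traceOut S (pureState ψ) = ∑ s : {i // i ∈ S} → A, pureState fun u => ψ (glue S u s) := by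
  ext u v
  rw [Matrix.sum_apply]
  rfl

variable [Fintype ι]

theorem sum_glue {M : Type*} [AddCommMonoid M] (S : Finset ι) (f : (ι → A) → M) :
    ∑ u : {i // i ∉ S} → A, ∑ s : {i // i ∈ S} → A, f (glue S u s) = ∑ z, f z := by
  rw [Finset.sum_comm, ← Fintype.sum_prod_type']
  exact Equiv.sum_comp (Equiv.piEquivPiSubtypeProd (· ∈ S) fun _ => A).symm f

/-- A family of Kraus operators which maps every branch of the erasure noise to a multiple of the
code state decodes the erasure. -/
theorem decodesErasures_of_kraus [DecidableEq A] {𝒞 : Submodule ℂ ((ι → A) → ℂ)} {S : Finset ι} {κ : Type*}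
    [Fintype κ] (K : κ → Matrix (ι → A) ({i // i ∉ S} → A) ℂ) (hK : ∑ k, (K k)ᴴ * K k = 1)
    (c : κ → ({i // i ∈ S} → A) → ℂ) (hc : ∑ k, ∑ s, c k s * star (c k s) = 1)
    (h : ∀ ψ ∈ 𝒞, ∀ k s, K k *ᵥ (fun u => ψ (glue S u s)) = c k s • ψ) :
    DecodesErasures 𝒞 S := by
  refine ⟨_, isQuantumChannel_of_kraus K hK, fun ψ hψ _ => ?_⟩
  simp only [traceOut_pureState, Matrix.mul_sum, Matrix.sum_mul, mul_pureState_mul_conjTranspose,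
    h ψ hψ, pureState_smul, ← Finset.sum_smul, hc, one_smul]

end Channel

/-! ### CSS codes: dimension, erasure decoding and distance -/

section CSS

theorem exists_star_eq_mul_self_eq_inv (n : ℕ) : ∃ a : ℂ, star a = a ∧ a * a = (n : ℂ)⁻¹ := by
  refine ⟨Complex.ofReal (√(n : ℝ))⁻¹, Complex.conj_ofReal _, ?_⟩
  rw [← Complex.ofReal_mul, ← mul_inv, Real.mul_self_sqrt n.cast_nonneg]
  simp

open Classical in
theorem sum_ite_sub_mem {K V : Type*} [Ring K] [AddCommGroup V] [Module K V] [Fintype V]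
    (N : Submodule K V) (w : V) :
    ∑ z : V, (if z - w ∈ N then (1 : ℂ) else 0) = Fintype.card N := by
  rw [Fintype.card_subtype, ← Finset.sum_boole]
  exact Fintype.sum_equiv (Equiv.subRight w) _ _ fun z => rfl

variable {ι F : Type*} [Fintype ι] [Field F] [Fintype F]

open Classical in
/-- The vector `∑_{y ∈ C^⊥} |x + y⟩`. -/
noncomputable def cssState (C : Submodule F (ι → F)) (x : ι → F) : (ι → F) → ℂ :=
  ∑ y : ι → F with y ∈ dualCode C, Pi.single (x + y) (1 : ℂ)

theorem cssState_mem_cssCode {CX CZ : Submodule F (ι → F)} {x : ι → F} (hx : x ∈ CZ) :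
    cssState CX x ∈ cssCode CX CZ :=
  Submodule.subset_span ⟨x, hx, rfl⟩

open Classical in
theorem cssState_apply (C : Submodule F (ι → F)) (x z : ι → F) :
    cssState C x z = if z - x ∈ dualCode C then 1 else 0 := by
  have h : ∀ y : ι → F, (Pi.single (x + y) (1 : ℂ) : (ι → F) → ℂ) z =
      if y = z - x then 1 else 0 := fun y => by
    rw [Pi.single_apply]
    exact if_congr ⟨fun h => by rw [h]; abel, fun h => by rw [h]; abel⟩ rfl rfl
  rw [cssState, Finset.sum_apply, Finset.sum_congr rfl fun y _ => h y, Finset.sum_ite_eq']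
  simp

/-- Each spanning vector is the indicator of a coset of `dualCode CX` inside `CZ`. This support
property and the coset invariance in the next lemma are all that the decoder uses about code states.
-/
theorem cssCode_apply_eq_zero {CX CZ : Submodule F (ι → F)} (h : dualCode CX ≤ CZ)
    {ψ : (ι → F) → ℂ} (hψ : ψ ∈ cssCode CX CZ) {z : ι → F} (hz : z ∉ CZ) : ψ z = 0 := by
  induction hψ using Submodule.span_induction with
  | mem v hv =>
    obtain ⟨x, hx, rfl⟩ := hv
    refine (cssState_apply CX x z).trans (if_neg ?_)
    intro hzx
    exact hz (by simpa using CZ.add_mem (h hzx) hx)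
  | zero => rfl
  | add a b _ _ ha hb => simp [ha, hb]
  | smul t a _ ha => simp [ha]

theorem cssCode_apply_eq_of_sub_mem {CX CZ : Submodule F (ι → F)}
    {ψ : (ι → F) → ℂ} (hψ : ψ ∈ cssCode CX CZ) {z w : ι → F} (hzw : z - w ∈ dualCode CX) :
    ψ z = ψ w := by
  classical
  induction hψ using Submodule.span_induction with
  | mem v hv =>
    obtain ⟨x, hx, rfl⟩ := hv
    refine (cssState_apply CX x z).trans (Eq.trans ?_ (cssState_apply CX x w).symm)
    refine if_congr ⟨fun h => ?_, fun h => ?_⟩ rfl rfl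
    · simpa using (dualCode CX).sub_mem h hzw
    · simpa using (dualCode CX).add_mem hzw h
  | zero => rfl
  | add a b _ _ ha hb => simp [ha, hb]
  | smul t a _ ha => simp [ha]

/-- The dimension of a CSS code is at least the number of cosets of `CX^⊥` in `CZ`. -/
theorem pow_le_finrank_cssCode {CX CZ : Submodule F (ι → F)} (h : dualCode CX ≤ CZ) :
    Fintype.card F ^ (Module.finrank F CZ - Module.finrank F (dualCode CX)) ≤
      Module.finrank ℂ (cssCode CX CZ) := by
  classical
  set N := (dualCode CX).comap CZ.subtype with hN
  let Q := CZ ⧸ N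
  let rep : Q → CZ := Quotient.out
  have hrep : ∀ q : Q, Submodule.Quotient.mk (rep q) = q := fun q => Quotient.out_eq q
  let v : Q → cssCode CX CZ := fun q =>
    ⟨cssState CX (rep q), cssState_mem_cssCode (rep q).2⟩
  have hv : ∀ q q', (v q : (ι → F) → ℂ) (rep q') = if q = q' then 1 else 0 := fun q q' => by
    refine (cssState_apply CX _ _).trans (if_congr ?_ rfl rfl)
    rw [eq_comm, ← hrep q, ← hrep q', Submodule.Quotient.eq, hrep, hrep]
    rfl
  have hli : LinearIndependent ℂ v := by
    rw [Fintype.linearIndependent_iff]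
    intro g hg q
    have := congrFun (congrArg Subtype.val hg) (rep q)
    simpa [hv, Finset.sum_apply] using this
  have hcard := hli.fintype_card_le_finrank
  have hQ : Module.finrank F Q = Module.finrank F CZ - Module.finrank F (dualCode CX) := by
    rw [Submodule.finrank_quotient, hN, LinearEquiv.finrank_eq (Submodule.comapSubtypeEquivOfLe h)]
  rwa [Module.card_eq_pow_finrank (K := F) (V := Q), hQ] at hcard

/-- A CSS code with `C^⊥ ⊆ C` decodes the erasure of `S` if no word of `C \ C^⊥` is supported
in `S`. -/
theorem decodesErasures_cssCode [DecidableEq ι] [DecidableEq F] {C : Submodule F (ι → F)}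
    (hC : dualCode C ≤ C) {S : Finset ι} (hS : C ⊓ vanishingOn F Sᶜ ≤ dualCode C) :
    DecodesErasures (cssCode C C) S := by
  classical
  set N := dualCode C with hN
  obtain ⟨p, hpS, hpp, hpN, hpB, hpC⟩ :=
    exists_idempotent_of_le_sup hC hS (le_dualCode_sup_vanishingOn hS)
  let e : ({i // i ∉ S} → F) → (ι → F) := fun u => glue S u 0
  have he : ∀ u s, glue S u s = e u + glue S 0 s := fun u s => by
    ext i
    by_cases hi : i ∈ S <;> simp [e, glue, hi]
  have he_inj : Function.Injective e := fun u u' h => by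
    ext i
    have := congrFun h i
    simpa [e, glue, i.2] using this
  have he_van : ∀ v : ι → F, (∀ i ∈ S, v i = 0) → e (fun i => v i) = v := fun v hv => by
    ext i
    by_cases hi : i ∈ S <;> simp [e, glue, hi, hv]
  have hpg : ∀ u s, p (glue S u s) = p (e u) := fun u s => by
    have h0 : p (glue S 0 s) = 0 := hpB _ fun i hi => by simp [glue, Finset.mem_compl.1 hi]
    rw [he, map_add, h0, add_zero]
  obtain ⟨a, hstar, haa⟩ := exists_star_eq_mul_self_eq_inv (Fintype.card N)
  have hNne : (Fintype.card N : ℂ) ≠ 0 := by exact_mod_cast Fintype.card_ne_zero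
  have hcount : ∀ w : ι → F, ∑ z : ι → F, (if z - w ∈ N then (1 : ℂ) else 0) = Fintype.card N :=
    fun w => by rw [← sum_ite_sub_mem N w]
  -- With `e u` the surviving string padded by zeros, `p (e u)` is the logical coset and `e u - p (e
  -- u)` a syndrome, equal to some `e m`. The operator `m` sends `u` to the normalized uniform
  -- superposition of `p (e u) + N` if its syndrome is `e m`, and to 0 otherwise.
  refine decodesErasures_of_kraus
    (fun m : {i // i ∉ S} → F => Matrix.of fun z u =>
      if e u - p (e u) = e m ∧ z - p (e u) ∈ N then a else 0) ?_
    (fun m s => if glue S m s ∈ N then a else 0) ?_ ?_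
  · ext u u'
    rw [Matrix.sum_apply]
    simp only [Matrix.mul_apply, Matrix.conjTranspose_apply, Matrix.of_apply, Matrix.one_apply]
    by_cases huu : u = u'
    · subst huu
      have h1 : ∀ m z, (star (if e u - p (e u) = e m ∧ z - p (e u) ∈ N then a else 0) *
          (if e u - p (e u) = e m ∧ z - p (e u) ∈ N then a else 0) : ℂ) =
          (if e m = e u - p (e u) then 1 else 0) *
            ((a * a) * if z - p (e u) ∈ N then (1 : ℂ) else 0) := fun m z => by
        by_cases h1 : e u - p (e u) = e m <;> by_cases h2 : z - p (e u) ∈ N <;>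
          simp [h1, h2, hstar, eq_comm (a := e m)]
      simp only [h1, ← Finset.mul_sum, hcount, haa, inv_mul_cancel₀ hNne, mul_one, if_true]
      obtain ⟨m₀, hm₀⟩ : ∃ m₀, e m₀ = e u - p (e u) :=
        ⟨_, he_van _ fun i hi => by simp [hpS _ i hi, e, glue, hi]⟩
      simp [← hm₀, he_inj.eq_iff]
    · rw [if_neg huu]
      refine Finset.sum_eq_zero fun m _ => Finset.sum_eq_zero fun z _ => ?_
      by_contra hne
      have h1 : e u - p (e u) = e m ∧ z - p (e u) ∈ N := by
        by_contra h
        simp [h] at hne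
      have h2 : e u' - p (e u') = e m ∧ z - p (e u') ∈ N := by
        by_contra h
        simp [h] at hne
      -- Distinct inputs with the same syndrome have disjoint output cosets, since `p` kills `N` and
      -- is idempotent.
      have h3 : p (e u) = p (e u') := by
        have h4 := hpN _ (N.sub_mem h2.2 h1.2)
        rwa [sub_sub_sub_cancel_left, map_sub, hpp, hpp, sub_eq_zero] at h4
      refine huu (he_inj ?_)
      have := h1.1.trans h2.1.symm
      rwa [h3, sub_left_inj] at this
  · have h1 : ∀ m s, ((if glue S m s ∈ N then a else 0) * star (if glue S m s ∈ N then a else 0) : ℂ)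
        = (a * a) * if glue S m s - 0 ∈ N then (1 : ℂ) else 0 := fun m s => by
      by_cases h : glue S m s ∈ N <;> simp [h, hstar]
    simp only [h1, ← Finset.mul_sum]
    rw [sum_glue S fun z => if z - 0 ∈ N then (1 : ℂ) else 0, hcount, haa, inv_mul_cancel₀ hNne]
  · intro ψ hψ m s
    ext z
    simp only [Matrix.mulVec, dotProduct, Matrix.of_apply, Pi.smul_apply, smul_eq_mul]
    -- Subtracting `p (e u)` from `glue S u s` gives `glue S m s`. If that lies in `N`, then `glue S
    -- u s` and `z` share a coset of `N`. Otherwise `glue S u s` is outside `C`, because `p` is the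
    -- identity on `C` modulo `N`, and `ψ` vanishes there.
    have hterm : ∀ u, e u - p (e u) = e m → z - p (e u) ∈ N →
        ψ (glue S u s) = if glue S m s ∈ N then ψ z else 0 := fun u h1 h2 => by
      have h3 : glue S u s - p (e u) = glue S m s := by
        rw [he u, he m, ← h1]
        abel
      split_ifs with hm
      · rw [cssCode_apply_eq_of_sub_mem hψ h2]
        exact cssCode_apply_eq_of_sub_mem hψ (h3 ▸ hm)
      · refine cssCode_apply_eq_zero hC hψ fun hu => hm ?_
        rw [← h3, ← hpg u s]
        exact hpC _ hu
    by_cases hm : glue S m s ∈ N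
    swap
    · rw [if_neg hm, zero_mul]
      refine Finset.sum_eq_zero fun u _ => ?_
      split_ifs with h
      · rw [hterm u h.1 h.2, if_neg hm, mul_zero]
      · rw [zero_mul]
    rw [if_pos hm]
    by_cases hz : z ∈ C
    swap
    · rw [cssCode_apply_eq_zero hC hψ hz, mul_zero]
      refine Finset.sum_eq_zero fun u _ => ?_
      split_ifs with h
      · rw [hterm u h.1 h.2, cssCode_apply_eq_zero hC hψ hz, ite_self, mul_zero]
      · rw [zero_mul]
    have hpm : p (e m) = 0 := by rw [← hpg m s, hpN _ hm]
    -- Only this input contributes at `z`: the coset condition forces `p (e u) = p z`, and the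
    -- syndrome then determines `u`.
    obtain ⟨u₀, hu₀⟩ : ∃ u₀, e u₀ = e m + p z :=
      ⟨_, he_van _ fun i hi => by simp [hpS _ i hi, e, glue, hi]⟩
    have hpu₀ : p (e u₀) = p z := by rw [hu₀, map_add, hpm, hpp, zero_add]
    rw [Finset.sum_eq_single u₀]
    · have h1 : e u₀ - p (e u₀) = e m := by rw [hpu₀, hu₀, add_sub_cancel_right]
      have h2 : z - p (e u₀) ∈ N := hpu₀ ▸ hpC z hz
      rw [if_pos ⟨h1, h2⟩, hterm u₀ h1 h2, if_pos hm]
    · intro u _ hu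
      rw [if_neg, zero_mul]
      rintro ⟨h1, h2⟩
      refine hu (he_inj ?_)
      have h3 := hpN _ h2
      rw [map_sub, hpp, sub_eq_zero] at h3
      rw [hu₀, h3, ← h1, sub_add_cancel]
    · simp

/-- A CSS code with `C^⊥ ⊊ C` does not decode the erasure of all qudits. -/
theorem not_decodesErasures_univ [DecidableEq ι] [DecidableEq F] {C : Submodule F (ι → F)}
    (hC : dualCode C < C) : ¬ DecodesErasures (cssCode C C) Finset.univ := by
  classical
  rintro ⟨Dec, -, hDec⟩
  obtain ⟨c, hc, hcN⟩ := SetLike.exists_of_lt hC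
  set N := dualCode C with hN
  obtain ⟨a, hstar, haa⟩ := exists_star_eq_mul_self_eq_inv (Fintype.card N)
  have hNne : (Fintype.card N : ℂ) ≠ 0 := by exact_mod_cast Fintype.card_ne_zero
  have hane : a ≠ 0 := by
    rintro h
    rw [h, zero_mul] at haa
    exact inv_ne_zero hNne haa.symm
  let φ : (ι → F) → (ι → F) → ℂ := fun x => a • cssState C x
  have hφ : ∀ x ∈ C, φ x ∈ cssCode C C := fun x hx =>
    Submodule.smul_mem _ _ (cssState_mem_cssCode hx)
  have hφ' : ∀ x z, φ x z = if z - x ∈ N then a else 0 := fun x z => by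
    simp [φ, cssState_apply, N]
  have hnorm : ∀ x, star (φ x) ⬝ᵥ φ x = 1 := fun x => by
    have h1 : ∀ z, star (φ x z) * φ x z = (a * a) * if z - x ∈ N then (1 : ℂ) else 0 := fun z => by
      by_cases h : z - x ∈ N <;> simp [hφ', h, hstar]
    simp only [dotProduct, Pi.star_apply, h1, ← Finset.mul_sum]
    rw [haa, sum_ite_sub_mem N x, inv_mul_cancel₀ hNne]
  have htr : ∀ ψ : (ι → F) → ℂ, star ψ ⬝ᵥ ψ = 1 →
      traceOut Finset.univ (pureState ψ) = Matrix.of fun _ _ => 1 := fun ψ hψ => by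
    have : IsEmpty {i : ι // i ∉ Finset.univ} := ⟨fun i => i.2 (Finset.mem_univ _)⟩
    ext u v
    have h1 := sum_glue Finset.univ fun z => ψ z * star (ψ z)
    rw [Fintype.sum_unique, Subsingleton.elim default u] at h1
    rw [Subsingleton.elim v u, Matrix.of_apply, ← hψ]
    refine h1.trans (Finset.sum_congr rfl fun z _ => mul_comm _ _)
  have h0 := hDec _ (hφ 0 C.zero_mem) (hnorm 0)
  have h1 := hDec _ (hφ c hc) (hnorm c)
  rw [htr _ (hnorm _)] at h0 h1
  -- With no qudit left, both states have the same reduced matrix. At entry (0, 0) the first state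
  -- gives `a * a`, the second 0, since 0 is not in `c + N`.
  have h2 := congrFun (congrFun (h0.symm.trans h1) 0) 0
  have hcN' : -c ∉ N := fun h => hcN (by simpa using N.neg_mem h)
  simp [pureState, Matrix.vecMulVec_apply, hφ', hcN', hane] at h2

/-- The distance of a CSS code with `C^⊥ ⊊ C` exists, and it is at least the minimum weight of the
words in `C \ C^⊥`. -/
theorem exists_hasDistance_cssCode [DecidableEq ι] [DecidableEq F] {C : Submodule F (ι → F)}
    (hC : dualCode C < C) {e : ℕ}
    (he : ∀ c ∈ C, c ∉ dualCode C → e ≤ (Finset.univ.filter fun i => c i ≠ 0).card) :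
    ∃ d, HasDistance (cssCode C C) d ∧ e ≤ d := by
  set D := {e : ℕ | ∀ S : Finset ι, S.card < e → DecodesErasures (cssCode C C) S} with hD
  have heD : e ∈ D := fun S hS => decodesErasures_cssCode hC.le fun c hc => by
    by_contra hcN
    refine absurd ((he c hc.1 hcN).trans (Finset.card_le_card fun i hi => ?_)) hS.not_ge
    by_contra hiS
    exact (Finset.mem_filter.1 hi).2 (hc.2 i (Finset.mem_compl.2 hiS))
  have hbdd : BddAbove D := ⟨Fintype.card ι, fun n hn => by
    by_contra! hlt
    exact not_decodesErasures_univ hC (hn _ hlt)⟩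
  exact ⟨sSup D, ⟨Nat.sSup_mem ⟨e, heD⟩ hbdd, fun n hn => le_csSup hbdd hn⟩, le_csSup hbdd heD⟩

end CSS

/-- If a subset `Z` of a finite group is dense, then many of its elements are mapped into `Z` by
many elements of a subgroup `H`. -/
theorem card_mul_sq_le_card_mul_sum_card {G : Type*} [Group G] [Fintype G] [DecidableEq G]
    (H : Subgroup G) [Fintype H] (Z : Finset G) :
    Fintype.card H * Z.card ^ 2 ≤
      Fintype.card G * ∑ h : H, (Z.filter fun x => (h : G) * x ∈ Z).card := by
  let χ : G → ℕ := fun x => if x ∈ Z then 1 else 0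
  have hχ : ∑ x, χ x = Z.card := by simp [χ]
  have hshift : ∀ g : G, ∑ x, χ (g * x) = Z.card := fun g =>
    (Equiv.sum_comp (Equiv.mulLeft g) χ).trans hχ
  have hN : ∀ g : G, ∑ x, χ x * χ (g * x) = (Z.filter fun x => g * x ∈ Z).card := fun g => by
    have : ∀ x, χ x * χ (g * x) = if x ∈ Z ∧ g * x ∈ Z then 1 else 0 := fun x => by
      by_cases h1 : x ∈ Z <;> by_cases h2 : g * x ∈ Z <;> simp [χ, h1, h2]
    rw [Finset.sum_congr rfl fun x _ => this x, Finset.sum_boole, Nat.cast_id]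
    congr 1
    ext x
    simp
  -- The function counting `h` with `h * x ∈ Z` has first moment |H||Z|. Its second moment counts
  -- pairs (h, k), which after translation depend only on k h⁻¹. Cauchy–Schwarz compares the two.
  have h1 : ∑ x, ∑ h : H, χ (h * x) = Fintype.card H * Z.card := by
    rw [Finset.sum_comm]
    simp [hshift]
  have h2 : ∑ x, (∑ h : H, χ (h * x)) ^ 2 =
      Fintype.card H * ∑ h : H, (Z.filter fun x => (h : G) * x ∈ Z).card := by
    simp only [sq, Finset.sum_mul_sum]
    rw [Finset.sum_comm]
    have : ∀ h : H, ∑ x, ∑ k : H, χ (h * x) * χ (k * x) =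
        ∑ k : H, (Z.filter fun x => (k : G) * x ∈ Z).card := fun h => by
      rw [Finset.sum_comm, ← Equiv.sum_comp (Equiv.mulRight h)]
      refine Finset.sum_congr rfl fun k _ => ?_
      rw [← hN, ← Equiv.sum_comp (Equiv.mulLeft (h : G)) fun x => χ x * χ (k * x)]
      simp [mul_assoc]
    simp [this]
  have h3 := sq_sum_le_card_mul_sum_sq (s := Finset.univ) (f := fun x => ∑ h : H, χ (h * x))
  rw [h1, h2, Finset.card_univ, Nat.cast_id] at h3
  have hpos : 0 < Fintype.card H := Fintype.card_pos
  refine Nat.le_of_mul_le_mul_left ?_ hpos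
  calc _ = (Fintype.card H * Z.card) ^ 2 := by ring
    _ ≤ _ := h3
    _ = _ := by ring

/-! ### Evaluation codes on the unit group -/

section EvaluationCode

open Polynomial

variable {F : Type*} [Field F]

theorem ev_apply (f : F[X]) (x : Fˣ) : ev F f x = f.eval (x : F) := rfl

theorem ev_mem_evCode {S : Set ℕ} {f : F[X]} (hf : f ∈ polysOn F S) : ev F f ∈ evCode F S :=
  Submodule.mem_map_of_mem hf

theorem X_pow_mem_polysOn {S : Set ℕ} {i : ℕ} (hi : i ∈ S) : (X ^ i : F[X]) ∈ polysOn F S :=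
  fun j hj => by
    rw [coeff_X_pow, if_neg]
    rintro rfl
    exact hj hi

variable [Fintype F] [DecidableEq F]

/-- The sum of x^k over the units is -1 if q - 1 divides k and 0 otherwise, so monomials pair
nontrivially only when their exponents sum to 0 mod q - 1. -/
theorem ev_dotProduct_ev (f g : F[X]) :
    ev F f ⬝ᵥ ev F g = ∑ j ∈ f.support, ∑ i ∈ g.support,
      f.coeff j * g.coeff i * if Fintype.card F - 1 ∣ j + i then -1 else 0 := by
  simp only [← FiniteField.sum_pow_units F, dotProduct, ev_apply, eval_eq_sum, Polynomial.sum]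
  simp only [Finset.sum_mul_sum]
  rw [Finset.sum_comm]
  refine Finset.sum_congr rfl fun j _ => ?_
  rw [Finset.sum_comm]
  refine Finset.sum_congr rfl fun i _ => ?_
  rw [Finset.mul_sum]
  refine Finset.sum_congr rfl fun x _ => ?_
  rw [pow_add]
  ring

theorem ev_dotProduct_ev_eq_zero {S T : Set ℕ} (h : ∀ j ∈ S, ∀ i ∈ T, ¬ Fintype.card F - 1 ∣ j + i)
    {f g : F[X]} (hf : f ∈ polysOn F S) (hg : g ∈ polysOn F T) : ev F f ⬝ᵥ ev F g = 0 := by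
  rw [ev_dotProduct_ev]
  refine Finset.sum_eq_zero fun j hj => Finset.sum_eq_zero fun i hi => ?_
  rw [if_neg, mul_zero]
  refine h j ?_ i ?_
  · by_contra hjS
    exact mem_support_iff.1 hj (hf j hjS)
  · by_contra hiT
    exact mem_support_iff.1 hi (hg i hiT)

/-- The coefficients of a reduced polynomial are dot products with evaluations of monomials. -/
theorem ev_dotProduct_ev_X_pow {f : F[X]} {i j : ℕ} (hf : f.degree < (Fintype.card F - 1 : ℕ))
    (hj : j < Fintype.card F - 1) (hij : Fintype.card F - 1 ∣ j + i) :
    ev F f ⬝ᵥ ev F (X ^ i) = -f.coeff j := by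
  rw [ev_dotProduct_ev]
  simp only [support_X_pow, Finset.sum_singleton, coeff_X_pow_self, mul_one]
  rw [Finset.sum_eq_single j]
  · simp [hij]
  · intro k hk hkj
    rw [if_neg, mul_zero]
    intro hki
    have hkn : k < Fintype.card F - 1 := by
      exact_mod_cast (le_degree_of_mem_supp k hk).trans_lt hf
    have : k ≡ j [MOD Fintype.card F - 1] :=
      Nat.ModEq.add_right_cancel' i <|
        ((Nat.modEq_zero_iff_dvd.2 hki)).trans (Nat.modEq_zero_iff_dvd.2 hij).symm
    exact hkj (Nat.ModEq.eq_of_lt_of_lt this hkn hj)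
  · intro hj
    simp [notMem_support_iff.1 hj]

theorem exists_degree_lt_ev_eq (c : Fˣ → F) :
    ∃ f : F[X], f.degree < (Fintype.card F - 1 : ℕ) ∧ ev F f = c := by
  have hinj : Set.InjOn (fun x : Fˣ => (x : F)) (Finset.univ : Finset Fˣ) :=
    Units.val_injective.injOn
  refine ⟨Lagrange.interpolate Finset.univ (fun x : Fˣ => (x : F)) c, ?_, ?_⟩
  · refine (Lagrange.degree_interpolate_lt c hinj).trans_eq ?_
    rw [Finset.card_univ, Fintype.card_units]
  · ext x
    exact Lagrange.eval_interpolate_at_node c hinj (Finset.mem_univ x)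

theorem card_le_finrank_evCode {S : Set ℕ} {T : Finset ℕ} (hTS : ∀ i ∈ T, i ∈ S)
    (hT : ∀ i ∈ T, i < Fintype.card F - 1) : T.card ≤ Module.finrank F (evCode F S) := by
  let v : T → evCode F S := fun i => ⟨ev F (X ^ (i : ℕ)), ev_mem_evCode (X_pow_mem_polysOn (hTS i i.2))⟩
  have hli : LinearIndependent F v := by
    rw [Fintype.linearIndependent_iff]
    intro g hg i
    have hpos : 0 < Fintype.card F - 1 := Nat.zero_lt_of_lt (hT i i.2)
    set f : F[X] := ∑ k : T, g k • X ^ (k : ℕ) with hf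
    have hev : ev F f = 0 := by
      have h := congrArg Subtype.val hg
      rw [hf, map_sum]
      simpa [v] using h
    have hdeg : f.degree < (Fintype.card F - 1 : ℕ) := by
      refine (degree_sum_le _ _).trans_lt ((Finset.sup_lt_iff (WithBot.bot_lt_coe _)).2 fun k _ => ?_)
      refine (degree_smul_le _ _).trans_lt ?_
      rw [degree_X_pow]
      exact_mod_cast hT k k.2
    have h1 := ev_dotProduct_ev_X_pow (i := Fintype.card F - 1 - i) hdeg (hT i i.2)
      (by rw [Nat.add_sub_cancel' (hT i i.2).le])
    rw [hev, zero_dotProduct, zero_eq_neg, hf, finsetSum_coeff, Finset.sum_eq_single i] at h1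
    · simpa using h1
    · intro k _ hk
      rw [coeff_smul, coeff_X_pow, if_neg fun h => hk (Subtype.ext h.symm), smul_zero]
    · simp
  simpa using hli.fintype_card_le_finrank

end EvaluationCode

/-! ### The Tamo–Barg code: self-orthogonality, weights and dimension -/

section TamoBarg

open Polynomial

variable {F : Type*} [Field F] [Fintype F] {r ℓ : ℕ}

/-- The monomials `X ^ i` with `i ≡ 1 mod r` are orthogonal to the Tamo-Barg code. -/
theorem evCode_modEq_one_le_dualCode [DecidableEq F] (hr : 3 ≤ r) (hrq : r ∣ Fintype.card F - 1) :
    evCode F {i | i ≡ 1 [MOD r]} ≤ dualCode (qTBClassical F r ℓ) := by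
  rintro _ ⟨f, hf, rfl⟩ _ ⟨g, hg, rfl⟩
  refine ev_dotProduct_ev_eq_zero ?_ hf hg
  intro j hj i hi hdvd
  have h0 : i + 1 ≡ 0 [MOD r] := by
    refine Nat.ModEq.trans ?_ (Nat.modEq_zero_iff_dvd.2 (hrq.trans hdvd))
    rw [add_comm j]
    exact (Nat.ModEq.refl i).add hj.symm
  have h1 : i ≡ r - 1 [MOD r] := by
    refine Nat.ModEq.add_right_cancel' 1 (h0.trans ?_)
    rw [Nat.sub_add_cancel (by omega)]
    exact (Nat.modEq_zero_iff_dvd.2 dvd_rfl).symm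
  rcases hi with hi | hi
  · exact hi.2 h1
  · have h2 : r - 1 ≡ 1 [MOD r] := h1.symm.trans hi.2
    have := h2.eq_of_lt_of_lt (by omega) (by omega)
    omega

theorem lt_of_mem_qTBSupport {q i : ℕ} (hℓ : ℓ < q) (hi : i ∈ qTBSupport q r ℓ) : i < q - 1 := by
  rcases hi with hi | hi
  · have := hi.1
    omega
  · exact hi.1

/-- Pairing with X^(q-1-j) extracts the coefficient at j, so it suffices that the reflection j ↦
q-1-j maps exponents outside the support into it. Modulo r it swaps the classes 1 and -1, and it
sends j ≥ ℓ below ℓ because q ≤ 2ℓ. -/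
theorem dualCode_qTBClassical_le [DecidableEq F] (hr : 3 ≤ r) (hrq : r ∣ Fintype.card F - 1)
    (hℓ : ℓ < Fintype.card F) (hq : Fintype.card F ≤ 2 * ℓ) :
    dualCode (qTBClassical F r ℓ) ≤ qTBClassical F r ℓ := by
  intro c hc
  obtain ⟨f, hdeg, rfl⟩ := exists_degree_lt_ev_eq c
  refine ev_mem_evCode fun j hj => ?_
  by_cases hjn : j < Fintype.card F - 1
  swap
  · exact coeff_eq_zero_of_degree_lt (hdeg.trans_le (by exact_mod_cast not_lt.1 hjn))
  suffices h : Fintype.card F - 1 - j ∈ qTBSupport (Fintype.card F) r ℓ by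
    rw [← neg_eq_zero, ← ev_dotProduct_ev_X_pow hdeg hjn (i := Fintype.card F - 1 - j)
      (by rw [Nat.add_sub_cancel' hjn.le])]
    exact hc _ (ev_mem_evCode (X_pow_mem_polysOn h))
  obtain ⟨m, hm⟩ := hrq
  -- The reflection of 0 would be q - 1, which is out of range; but 0 itself is in the support.
  have hj0 : j ≠ 0 := by
    rintro rfl
    refine hj (Or.inl ⟨by omega, fun h => ?_⟩)
    have := h.eq_of_lt_of_lt (by omega) (by omega)
    omega
  have hsum : Fintype.card F - 1 - j + j ≡ 0 [MOD r] := by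
    rw [Nat.sub_add_cancel hjn.le]
    exact Nat.modEq_zero_iff_dvd.2 ⟨m, hm⟩
  have hr1 : r - 1 + 1 ≡ 0 [MOD r] := by
    rw [Nat.sub_add_cancel (by omega)]
    exact Nat.modEq_zero_iff_dvd.2 dvd_rfl
  by_cases h1 : Fintype.card F - 1 - j ≡ 1 [MOD r]
  · exact Or.inr ⟨by omega, h1⟩
  have hj1 : ¬ j ≡ r - 1 [MOD r] := fun h => h1 <| by
    refine Nat.ModEq.add_right_cancel' j (hsum.trans ?_)
    refine Nat.ModEq.trans ?_ ((Nat.ModEq.refl 1).add h.symm)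
    rw [add_comm]
    exact hr1.symm
  have hjℓ : ℓ ≤ j := by
    by_contra! h
    exact hj (Or.inl ⟨h, hj1⟩)
  refine Or.inl ⟨by omega, fun h => hj (Or.inr ⟨hjn, ?_⟩)⟩
  refine Nat.ModEq.add_left_cancel' (r - 1) ?_
  exact (((h.symm.add_right j).trans hsum).trans hr1.symm)

/-- The all-ones word separates the two codes: its dot product with itself is -1. Strictness makes
the distance finite, since a one-dimensional quantum code decodes every erasure. -/
theorem dualCode_qTBClassical_lt [DecidableEq F] (hr : 3 ≤ r) (hrq : r ∣ Fintype.card F - 1)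
    (h : dualCode (qTBClassical F r ℓ) ≤ qTBClassical F r ℓ) :
    dualCode (qTBClassical F r ℓ) < qTBClassical F r ℓ := by
  have hmem : ev F (X ^ 0) ∈ qTBClassical F r ℓ := by
    rcases Nat.eq_zero_or_pos ℓ with rfl | hℓ
    · refine h ?_
      rintro _ ⟨g, hg, rfl⟩
      refine ev_dotProduct_ev_eq_zero (S := {0}) ?_ (X_pow_mem_polysOn rfl) hg
      rintro _ rfl i (hi | hi) hdvd
      · exact Nat.not_lt_zero _ hi.1
      · rw [zero_add] at hdvd
        have h0 : 1 ≡ 0 [MOD r] := hi.2.symm.trans (Nat.modEq_zero_iff_dvd.2 (hrq.trans hdvd))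
        have := h0.eq_of_lt_of_lt (by omega) (by omega)
        omega
    · refine ev_mem_evCode (X_pow_mem_polysOn (Or.inl ⟨hℓ, fun h => ?_⟩))
      have := h.eq_of_lt_of_lt (by omega) (by omega)
      omega
  refine lt_of_le_of_ne h fun heq => ?_
  have h1 := (heq.ge hmem) _ hmem
  rw [ev_dotProduct_ev, support_X_pow, Finset.sum_singleton, Finset.sum_singleton] at h1
  simp at h1

/-- A word of `C \ C^⊥` has few pairs of zeros `x`, `η x` with `η` in the subgroup of order `r`. -/
theorem card_zeros_inter_le [DecidableEq F] (hr : 3 ≤ r)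
    (hrq : r ∣ Fintype.card F - 1) {f : F[X]} (hf : f ∈ polysOn F (qTBSupport (Fintype.card F) r ℓ))
    (hfd : ev F f ∉ dualCode (qTBClassical F r ℓ)) {η : Fˣ} (hη : orderOf η = r) :
    ((Finset.univ.filter fun x : Fˣ => f.eval (x : F) = 0).filter fun x =>
      η * x ∈ Finset.univ.filter fun x : Fˣ => f.eval (x : F) = 0).card + 1 ≤ ℓ := by
  -- `P` vanishes wherever x and ηx are both zeros of f, and its coefficient at i is that of f times
  -- η^i - η, which is zero precisely for i ≡ 1 mod r.
  set P : F[X] := f.comp (C (η : F) * X) - C (η : F) * f with hP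
  have hcoeff : ∀ i, P.coeff i = f.coeff i * ((η ^ i : Fˣ) - (η : F)) := fun i => by
    rw [hP, coeff_sub, comp_C_mul_X_coeff, coeff_C_mul, Units.val_pow_eq_pow_val]
    ring
  have hpow : ∀ i, η ^ i = η ↔ i ≡ 1 [MOD r] := fun i => by
    rw [← hη, ← pow_eq_pow_iff_modEq, pow_one]
  have hP0 : P ≠ 0 := by
    intro hP0
    refine hfd (evCode_modEq_one_le_dualCode hr hrq (ev_mem_evCode fun i hi => ?_))
    have h := hcoeff i
    rw [hP0, coeff_zero, eq_comm, mul_eq_zero, sub_eq_zero, Units.val_inj, hpow] at h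
    exact h.resolve_right hi
  have hdeg : P.natDegree < ℓ := by
    have hlead : P.coeff P.natDegree ≠ 0 := leadingCoeff_ne_zero.2 hP0
    rw [hcoeff] at hlead
    have h1 : P.natDegree ∈ qTBSupport (Fintype.card F) r ℓ := by
      by_contra h
      rw [hf _ h, zero_mul] at hlead
      exact hlead rfl
    rcases h1 with h1 | h1
    · exact h1.1
    · rw [(hpow _).2 h1.2, sub_self, mul_zero] at hlead
      exact absurd rfl hlead
  refine Nat.succ_le_of_lt (lt_of_le_of_lt ?_ hdeg)
  refine le_trans ?_ (card_roots' P)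
  refine le_trans ?_ (Multiset.toFinset_card_le _)
  refine Finset.card_le_card_of_injOn (fun x : Fˣ => (x : F)) (fun x hx => ?_)
    Units.val_injective.injOn
  simp only [Finset.coe_filter, Finset.mem_filter, Finset.mem_univ, true_and, Set.mem_ofPred_eq,
    Units.val_mul] at hx
  have hroot : P.IsRoot (x : F) := by simp [hP, hx.1, hx.2]
  exact Multiset.mem_toFinset.2 ((mem_roots hP0).2 hroot)

theorem card_zeros_sq_le [DecidableEq F] (hp : r.Prime) (hr : 3 ≤ r)
    (hrq : r ∣ Fintype.card F - 1) {f : F[X]} (hf : f ∈ polysOn F (qTBSupport (Fintype.card F) r ℓ))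
    (hfd : ev F f ∉ dualCode (qTBClassical F r ℓ)) :
    (r : ℝ) * ((Finset.univ.filter fun x : Fˣ => f.eval (x : F) = 0).card : ℝ) ^ 2 ≤
      Fintype.card Fˣ * ((Finset.univ.filter fun x : Fˣ => f.eval (x : F) = 0).card +
        ((r : ℝ) - 1) * ((ℓ : ℝ) - 1)) := by
  have : Fact r.Prime := ⟨hp⟩
  obtain ⟨ω, hω⟩ := exists_prime_orderOf_dvd_card (G := Fˣ) r (by rwa [Fintype.card_units])
  have hcard : Fintype.card (Subgroup.zpowers ω) = r := by rw [Fintype.card_zpowers, hω]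
  set Z := Finset.univ.filter fun x : Fˣ => f.eval (x : F) = 0 with hZ
  have h := card_mul_sq_le_card_mul_sum_card (Subgroup.zpowers ω) Z
  rw [hcard] at h
  have h' : (r : ℝ) * (Z.card : ℝ) ^ 2 ≤ Fintype.card Fˣ *
      ∑ h : Subgroup.zpowers ω, ((Z.filter fun x => (h : Fˣ) * x ∈ Z).card : ℝ) := by
    exact_mod_cast h
  refine h'.trans (mul_le_mul_of_nonneg_left ?_ (Nat.cast_nonneg _))
  -- The identity contributes |Z|. As r is prime, the other r - 1 elements have order r and
  -- contribute at most ℓ - 1 each.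
  rw [← Finset.add_sum_erase _ _ (Finset.mem_univ (1 : Subgroup.zpowers ω))]
  refine add_le_add ?_ ?_
  · exact_mod_cast Finset.card_filter_le _ _
  · refine (Finset.sum_le_card_nsmul _ _ ((ℓ : ℝ) - 1) fun η hη => ?_).trans_eq ?_
    · have hη1 : (η : Fˣ) ≠ 1 := fun h => (Finset.mem_erase.1 hη).1 (Subtype.ext h)
      have hdvd : orderOf (η : Fˣ) ∣ r := by
        rw [← hcard, Subgroup.orderOf_coe]
        exact orderOf_dvd_card
      have hord : orderOf (η : Fˣ) = r :=
        (hp.eq_one_or_self_of_dvd _ hdvd).resolve_left fun h => hη1 (orderOf_eq_one_iff.1 h)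
      have := card_zeros_inter_le hr hrq hf hfd hord
      rw [le_sub_iff_add_le]
      exact_mod_cast this
    · rw [Finset.card_erase_of_mem (Finset.mem_univ _), Finset.card_univ, hcard, nsmul_eq_mul,
        Nat.cast_sub (by omega), Nat.cast_one]

/-- The words of `C \ C^⊥` have large weight. -/
theorem le_card_support_of_notMem_dualCode [DecidableEq F] (hp : r.Prime) (hr : 3 ≤ r)
    (hrq : r ∣ Fintype.card F - 1) {c : Fˣ → F} (hc : c ∈ qTBClassical F r ℓ)
    (hcd : c ∉ dualCode (qTBClassical F r ℓ)) :
    (Fintype.card Fˣ : ℝ) * (1 - 1 / (2 * (r : ℝ)) - √(1 / (4 * (r : ℝ) ^ 2) +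
      ((r : ℝ) - 1) / r * (((ℓ : ℝ) - 1) / Fintype.card Fˣ))) ≤
      (Finset.univ.filter fun x => c x ≠ 0).card := by
  obtain ⟨f, hf, rfl⟩ := hc
  have hsq := card_zeros_sq_le hp hr hrq hf hcd
  have hsplit := Finset.card_filter_add_card_filter_not (s := (Finset.univ : Finset Fˣ))
    fun x => f.eval (x : F) = 0
  rw [Finset.card_univ] at hsplit
  set Z := Finset.univ.filter fun x : Fˣ => f.eval (x : F) = 0 with hZ
  have hn : (0 : ℝ) < Fintype.card Fˣ := by exact_mod_cast Fintype.card_pos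
  have hw : ((Finset.univ.filter fun x => ev F f x ≠ 0).card : ℝ) =
      Fintype.card Fˣ - Z.card := by
    rw [← hsplit, Nat.cast_add, add_sub_cancel_left]
    rfl
  rw [hw]
  set n : ℝ := (Fintype.card Fˣ : ℝ)
  have hr0 : (0 : ℝ) < r := by
    exact_mod_cast hp.pos
  -- The quadratic inequality for |Z|, divided by r n², with the square completed.
  have key : (Z.card / n - 1 / (2 * r)) ^ 2 ≤ 1 / (4 * (r : ℝ) ^ 2) +
      ((r : ℝ) - 1) / r * (((ℓ : ℝ) - 1) / n) := by
    have h1 : 1 / (4 * (r : ℝ) ^ 2) + ((r : ℝ) - 1) / r * (((ℓ : ℝ) - 1) / n) -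
        (Z.card / n - 1 / (2 * r)) ^ 2 =
        (n * (Z.card + ((r : ℝ) - 1) * ((ℓ : ℝ) - 1)) - r * (Z.card : ℝ) ^ 2) / (r * n ^ 2) := by
      field_simp
      ring
    rw [← sub_nonneg, h1]
    exact div_nonneg (sub_nonneg.2 hsq) (by positivity)
  have h2 := (abs_le.1 (Real.abs_le_sqrt key)).2
  have h3 : (Z.card : ℝ) = n * (Z.card / n) := by field_simp
  rw [h3, ← mul_one_sub]
  refine mul_le_mul_of_nonneg_left ?_ hn.le
  linarith

/-- A lower bound for the number of monomials of the Tamo-Barg code. -/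
theorem le_finrank_qTBClassical [DecidableEq F] (hr : 3 ≤ r) (hrq : r ∣ Fintype.card F - 1)
    (hℓ : ℓ < Fintype.card F) :
    (Fintype.card Fˣ : ℝ) / r + ℓ - 1 - 2 * (ℓ / r) ≤ Module.finrank F (qTBClassical F r ℓ) := by
  set n := Fintype.card Fˣ with hn
  have hnq : n = Fintype.card F - 1 := Fintype.card_units F
  rw [← hnq] at hrq
  have hr0 : 0 < r := by omega
  set A := (Finset.range n).filter (· ≡ 1 [MOD r])
  set B := (Finset.range ℓ).filter fun i => ¬ (i ≡ 1 [MOD r] ∨ i ≡ r - 1 [MOD r])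
  have hA : A.card = n / r := by
    rw [← Nat.count_eq_card_filter_range, Nat.count_modEq_card _ hr0,
      Nat.mod_eq_zero_of_dvd hrq]
    simp
  -- Below ℓ the class r - 1 has exactly ⌊ℓ/r⌋ members, as ℓ mod r never exceeds r - 1; the class 1
  -- may have one more.
  have hB : ℓ ≤ B.card + (2 * (ℓ / r) + 1) := by
    have h1 := Finset.card_filter_add_card_filter_not (s := Finset.range ℓ)
      fun i => i ≡ 1 [MOD r] ∨ i ≡ r - 1 [MOD r]
    rw [Finset.card_range, Finset.filter_or] at h1
    have h2 := Finset.card_union_le ((Finset.range ℓ).filter (· ≡ 1 [MOD r]))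
      ((Finset.range ℓ).filter (· ≡ r - 1 [MOD r]))
    rw [← Nat.count_eq_card_filter_range, ← Nat.count_eq_card_filter_range,
      Nat.count_modEq_card _ hr0, Nat.count_modEq_card _ hr0, Nat.mod_eq_of_lt (a := r - 1)
      (by omega), if_neg (c := r - 1 < ℓ % r) (by have := Nat.mod_lt ℓ hr0; omega)] at h2
    have h3 : (if 1 % r < ℓ % r then 1 else 0) ≤ 1 := by split_ifs <;> simp
    change _ + B.card = ℓ at h1
    omega
  have hdisj : Disjoint A B := Finset.disjoint_left.2 fun i hA hB =>
    (Finset.mem_filter.1 hB).2 (Or.inl (Finset.mem_filter.1 hA).2)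
  have hT : A.card + B.card ≤ Module.finrank F (qTBClassical F r ℓ) := by
    rw [← Finset.card_union_of_disjoint hdisj]
    have hmem : ∀ i ∈ A ∪ B, i ∈ qTBSupport (Fintype.card F) r ℓ := fun i hi => by
      rcases Finset.mem_union.1 hi with hi | hi <;>
        obtain ⟨h1, h2⟩ := Finset.mem_filter.1 hi
      · exact Or.inr ⟨hnq ▸ Finset.mem_range.1 h1, h2⟩
      · exact Or.inl ⟨Finset.mem_range.1 h1, fun h => h2 (Or.inr h)⟩
    exact card_le_finrank_evCode hmem fun i hi => lt_of_mem_qTBSupport hℓ (hmem i hi)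
  have hnr : ((n / r : ℕ) : ℝ) = n / r := Nat.cast_div hrq (by positivity)
  have hℓr : ((ℓ / r : ℕ) : ℝ) ≤ ℓ / r := Nat.cast_div_le
  have hB' : (ℓ : ℝ) ≤ B.card + (2 * (ℓ / r : ℕ) + 1) := by exact_mod_cast hB
  have hT' : (A.card : ℝ) + B.card ≤ Module.finrank F (qTBClassical F r ℓ) := by exact_mod_cast hT
  rw [hA, hnr] at hT'
  linarith

end TamoBarg

/-! ### Rate and the final bounds -/

/-- The rate of a CSS code in terms of the dimension of the classical code. -/
theorem finrank_div_card_le_rate_cssCode {ι F : Type*} [Fintype ι] [DecidableEq ι] [Nonempty ι]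
    [Field F] [Fintype F] [DecidableEq F] {C : Submodule F (ι → F)} (h : dualCode C ≤ C) :
    (Module.finrank F C : ℝ) / Fintype.card ι ≤ (1 + rate (cssCode C C)) / 2 := by
  have hq : (1 : ℝ) < Fintype.card F := by exact_mod_cast Fintype.one_lt_card
  have hn : (0 : ℝ) < Fintype.card ι := by exact_mod_cast Fintype.card_pos
  have hle : Module.finrank F (dualCode C) ≤ Module.finrank F C := Submodule.finrank_mono h
  have hsum : (Module.finrank F C : ℝ) + Module.finrank F (dualCode C) = Fintype.card ι := by
    exact_mod_cast finrank_add_finrank_dualCode C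
  have hpow : (Fintype.card F : ℝ) ^ (Module.finrank F C - Module.finrank F (dualCode C)) ≤
      Module.finrank ℂ (cssCode C C) := by
    exact_mod_cast pow_le_finrank_cssCode h
  have hlog := Real.logb_le_logb_of_le hq (pow_pos (by linarith) _) hpow
  rw [Real.logb_pow, Real.logb_self_eq_one hq, mul_one, Nat.cast_sub hle] at hlog
  have hrate : (2 * (Module.finrank F C : ℝ) - Fintype.card ι) / Fintype.card ι ≤
      rate (cssCode C C) := by
    rw [rate]
    exact div_le_div_of_nonneg_right (by linarith) hn.le
  rw [sub_div, div_self hn.ne', mul_div_assoc] at hrate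
  linarith

end QTB

theorem theorem6p1 :
    ∃ c : ℝ, ∀ (F : Type*) [Field F] [Fintype F] [DecidableEq F] (r ℓ : ℕ),
      r.Prime → 3 ≤ r → r ∣ Fintype.card F - 1 → ℓ < Fintype.card F →
      -- `CSS(C, C)` is a well-defined CSS code as soon as `ℓ ≥ q / 2`
      (Fintype.card F ≤ 2 * ℓ →
        QTB.dualCode (QTB.qTBClassical F r ℓ) ≤ QTB.qTBClassical F r ℓ) ∧
      -- and whenever it is a well-defined CSS code, its distance satisfies the two bounds
      (QTB.dualCode (QTB.qTBClassical F r ℓ) ≤ QTB.qTBClassical F r ℓ →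
        ∃ d : ℕ, QTB.HasDistance (QTB.qTBCode F r ℓ) d ∧
          ((Fintype.card F : ℝ) - 1) *
              (1 - 1 / (2 * (r : ℝ)) -
                √(1 / (4 * (r : ℝ) ^ 2) +
                  ((r : ℝ) - 1) / r * (((ℓ : ℝ) - 1) / ((Fintype.card F : ℝ) - 1)))) ≤ d ∧
          1 - √((1 + QTB.rate (QTB.qTBCode F r ℓ)) / 2) - c / r ≤
            (d : ℝ) / ((Fintype.card F : ℝ) - 1)) := by
  -- The constant 2 collects 1/(2r) from the distance bound and 1/(2r) + 1/r from estimating its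
  -- square root.
  refine ⟨2, fun F _ _ _ r ℓ hp hr hrq hℓ =>
    ⟨fun hq => QTB.dualCode_qTBClassical_le hr hrq hℓ hq, fun hdual => ?_⟩⟩
  have hlt := QTB.dualCode_qTBClassical_lt hr hrq hdual
  have hweight := fun c hc hcd => QTB.le_card_support_of_notMem_dualCode (F := F) (ℓ := ℓ) (c := c)
    hp hr hrq hc hcd
  have hcard : (Fintype.card F : ℝ) - 1 = Fintype.card Fˣ := by
    rw [Fintype.card_units, Nat.cast_sub Fintype.card_pos, Nat.cast_one]
  have hrn : (r : ℝ) ≤ Fintype.card Fˣ := by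
    rw [← Fintype.card_units] at hrq
    exact_mod_cast Nat.le_of_dvd Fintype.card_pos hrq
  have hℓn : (ℓ : ℝ) ≤ Fintype.card Fˣ := by
    rw [← hcard, le_sub_iff_add_le]
    exact_mod_cast hℓ
  have hfin := QTB.le_finrank_qTBClassical hr hrq hℓ
  have hrate := QTB.finrank_div_card_le_rate_cssCode hdual
  rw [hcard]
  set n : ℝ := (Fintype.card Fˣ : ℝ)
  have hr0 : (0 : ℝ) < r := by exact_mod_cast hp.pos
  have hn : 0 < n := hr0.trans_le hrn
  set x : ℝ := ((r : ℝ) - 1) / r * (((ℓ : ℝ) - 1) / n) with hx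
  obtain ⟨d, hd, hBd⟩ := QTB.exists_hasDistance_cssCode hlt
    (e := ⌈n * (1 - 1 / (2 * (r : ℝ)) - √(1 / (4 * (r : ℝ) ^ 2) + x))⌉₊)
    fun c hc hcd => Nat.ceil_le.2 (hweight c hc hcd)
  have hdist := (Nat.le_ceil _).trans (Nat.cast_le (α := ℝ).2 hBd)
  refine ⟨d, hd, hdist, ?_⟩
  change _ ≤ (1 + QTB.rate (QTB.qTBCode F r ℓ)) / 2 at hrate
  set y : ℝ := (1 + QTB.rate (QTB.qTBCode F r ℓ)) / 2
  have hy : 0 ≤ y := le_trans (by positivity) hrate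
  -- The dimension bound divided by n falls short of x by at most 1/(rn), since ℓ ≤ n, and 1/(rn) ≤
  -- 1/r² since r ≤ n.
  have hxy : x ≤ y + (1 / r) ^ 2 := by
    have h1 : x ≤ ((n / r + ℓ - 1 - 2 * (ℓ / r)) + 1 / r) / n := by
      rw [hx, div_mul_div_comm, ← sub_nonneg]
      have : ((n / r + ℓ - 1 - 2 * (ℓ / r)) + 1 / r) / n - ((r : ℝ) - 1) * ((ℓ : ℝ) - 1) / (r * n)
          = (n - ℓ) / (r * n) := by
        field_simp
        ring
      rw [this]
      exact div_nonneg (by linarith) (by positivity)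
    have h2 : 1 / r / n ≤ (1 / r : ℝ) ^ 2 := by
      rw [div_div, one_div_pow, sq]
      exact one_div_le_one_div_of_le (by positivity) (mul_le_mul_of_nonneg_left hrn hr0.le)
    have h3 := div_le_div_of_nonneg_right hfin hn.le
    rw [add_div] at h1
    linarith
  have hsqrt : √(1 / (4 * (r : ℝ) ^ 2) + x) ≤ 1 / (2 * r) + (√y + 1 / r) := by
    refine Real.sqrt_le_iff.2 ⟨by positivity, ?_⟩
    have h1 : (1 / (2 * r) + (√y + 1 / r)) ^ 2 =
        1 / (4 * (r : ℝ) ^ 2) + (√y ^ 2 + (1 / r) ^ 2) +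
          (2 * √y * (1 / r) + 2 * (1 / (2 * r)) * (√y + 1 / r)) := by
      field_simp
      ring
    rw [h1, Real.sq_sqrt hy]
    have : 0 ≤ 2 * √y * (1 / (r : ℝ)) + 2 * (1 / (2 * (r : ℝ))) * (√y + 1 / r) := by positivity
    linarith
  rw [le_div_iff₀ hn]
  refine le_trans ?_ hdist
  rw [mul_comm]
  refine mul_le_mul_of_nonneg_left ?_ hn.le
  have h2 : (2 : ℝ) / r = 1 / (2 * r) + 1 / (2 * r) + 1 / r := by
    field_simp
    ring
  linarith
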